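/- Let $g_a,g_x\ge 0$ be integers and let $\mathbb R\langle a,x\rangle$ be the algebra of real polynomials in the non-commuting variables $a=(a_1,\dots,a_{g_a})$ and $x=(x_1,\dots,x_{g_x})$, with the $\mathbb R$-linear involution ${}^T$ that reverses words and fixes each variable. Polynomials are evaluated at tuples $A=(A_1,\dots,A_{g_a})$, $X=(X_1,\dots,X_{g_x})$ of real symmetric $n\times n$ matrices. A polynomial $p=p^T$ is called (globally) convex in $x$ if $$t\,p(A,X)+(1-t)\,p(A,Y)-p(A,tX+(1-t)Y)\succeq 0$$ for every $n$, all tuples $A,X,Y$ of real symmetric $n\times n$ matrices and all $0<t<1$; convexity in $a$ is defined in the same way with the roles of $a$ and $x$ exchanged. Theorem. Let $p\in\mathbb R\langle a,x\rangle$ satisfy $p=p^T$. If $p$ is globally convex in $a$ and globally convex in $x$, separately, then there exist an integer $m\ge 0$ and polynomials $L,\Lambda_1,\dots,\Lambda_m\in\mathbb R\langle a,x\rangle$ such that $$p=L+\Lambda^T\Lambda=L+\sum_{j=1}^m\Lambda_j^T\Lambda_j,$$ and each of $L,\Lambda_1,\dots,\Lambda_m$ has degree at most one in $a$ and degree at most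 one in $x$, hence joint degree at most two. -/

import Mathlib

open scoped BigOperators

/-- The algebra `ℝ⟨a, x⟩` of noncommutative real polynomials in the letters
`a_i = ι (Sum.inl i)`, `i < ga`, and `x_j = ι (Sum.inr j)`, `j < gx`.
The involution `p ↦ pᵀ` (reverse words, fix letters and real scalars) is Mathlib's `star`
on the free algebra. -/
abbrev NCPoly (ga gx : ℕ) : Type := FreeAlgebra ℝ (Fin ga ⊕ Fin gx)

namespace NCPoly

variable {ga gx : ℕ}

/-- The finite set of words that occur in `p` with nonzero coefficient. -/
noncomputable def words (p : NCPoly ga gx) : Finset (FreeMonoid (Fin ga ⊕ Fin gx)) :=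
  (FreeAlgebra.equivMonoidAlgebraFreeMonoid p).coeff.support

/-- Degree in `a`: the largest number of `a`-letters in a word of `p` (`0` if `p = 0`). -/
noncomputable def aDegree (p : NCPoly ga gx) : ℕ :=
  p.words.sup fun w => w.toList.countP Sum.isLeft

/-- Degree in `x`: the largest number of `x`-letters in a word of `p` (`0` if `p = 0`). -/
noncomputable def xDegree (p : NCPoly ga gx) : ℕ :=
  p.words.sup fun w => w.toList.countP Sum.isRight

/-- Joint degree in `a` and `x`: the largest length of a word of `p` (`0` if `p = 0`). -/
noncomputable def jointDegree (p : NCPoly ga gx) : ℕ :=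
  p.words.sup fun w => w.toList.length

/-- The evaluation `p(A, X)` at tuples of `n × n` real matrices. -/
noncomputable def eval {n : ℕ} (A : Fin ga → Matrix (Fin n) (Fin n) ℝ)
    (X : Fin gx → Matrix (Fin n) (Fin n) ℝ) (p : NCPoly ga gx) : Matrix (Fin n) (Fin n) ℝ :=
  FreeAlgebra.lift ℝ (Sum.elim A X) p

/-- `p` is (globally) convex in `x`: for every size `n`, every tuple `A` and all tuples `X`, `Y`
of symmetric `n × n` matrices, and all `0 < t < 1`,
`t p(A, X) + (1 - t) p(A, Y) - p(A, t X + (1 - t) Y)` is positive semidefinite. -/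
def ConvexInX (p : NCPoly ga gx) : Prop :=
  ∀ (n : ℕ) (A : Fin ga → Matrix (Fin n) (Fin n) ℝ) (X Y : Fin gx → Matrix (Fin n) (Fin n) ℝ),
    (∀ i, (A i).IsSymm) → (∀ j, (X j).IsSymm) → (∀ j, (Y j).IsSymm) →
    ∀ t : ℝ, 0 < t → t < 1 →
      (t • p.eval A X + (1 - t) • p.eval A Y - p.eval A (t • X + (1 - t) • Y)).PosSemidef

/-- `p` is (globally) convex in `a`: the same condition with the roles of `a` and `x` exchanged. -/
def ConvexInA (p : NCPoly ga gx) : Prop :=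
  ∀ (n : ℕ) (A B : Fin ga → Matrix (Fin n) (Fin n) ℝ) (X : Fin gx → Matrix (Fin n) (Fin n) ℝ),
    (∀ i, (A i).IsSymm) → (∀ i, (B i).IsSymm) → (∀ j, (X j).IsSymm) →
    ∀ t : ℝ, 0 < t → t < 1 →
      (t • p.eval A X + (1 - t) • p.eval B X - p.eval (t • A + (1 - t) • B) X).PosSemidef

end NCPoly

/-! Convexity in one set of letters makes the second difference `p(z + h) + p(z - h) - 2 p(z)`
positive semidefinite on all symmetric tuples, hence by Helton's theorem a sum of squares `∑ Fₖᵀ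
Fₖ`. The rest is bookkeeping with words, driven by `exists_wordCoeff_sum_star_mul_pos`: extremal
words in a sum of squares cannot cancel. Each word of the second difference has at least two letters
`h`, so each word of `Fₖ` has at least one. Marking the first two selected letters of a word of top
degree shows that this degree is at most two. Thus the part of degree two in `x` is `∑ Pₖᵀ Pₖ` with
`Pₖ` homogeneous of degree one in `x`, and the part of degree two in `a` is likewise `∑ Qₖᵀ Qₖ`.

Extremality again bounds the `a`-degree of `Pₖ` and the `x`-degree of `Qₖ` by one. On words of
bidegree `(1, 1)` both families have the same Gram matrix, read off from the words of length four in
`p`. An orthogonal change of the `Pₖ` therefore makes them agree with the `Qₖ` there, and the two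
families glue to one family `Λₖ`. What `∑ Λₖᵀ Λₖ` leaves of `p` has degree at most one in each set.

Helton's theorem is proved by separation: a functional that separates `q` from the closed cone of
sums of squares is perturbed to have a positive definite Hankel matrix. A truncated GNS construction
then yields symmetric matrices on which `q` is not positive. -/

namespace FreeAlgebra

/-! ### Words, coefficients, and extremal words in sums of squares. -/

variable {σ τ : Type*}

/-- The monomial of `ℝ⟨σ⟩` given by a word. -/
noncomputable def word (w : List σ) : FreeAlgebra ℝ σ := (w.map (ι ℝ)).prod

/-- The coefficient of a word, as a linear functional on `ℝ⟨σ⟩`. -/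
noncomputable def wordCoeff (w : List σ) : FreeAlgebra ℝ σ →ₗ[ℝ] ℝ where
  toFun p := (equivMonoidAlgebraFreeMonoid p).coeff (FreeMonoid.ofList w)
  map_add' p q := by simp
  map_smul' c p := by simp

theorem wordCoeff_apply (w : List σ) (p : FreeAlgebra ℝ σ) :
    wordCoeff w p = (equivMonoidAlgebraFreeMonoid p).coeff (FreeMonoid.ofList w) := rfl

@[simp] theorem word_nil : word ([] : List σ) = 1 := rfl

theorem word_cons (s : σ) (w : List σ) : word (s :: w) = ι ℝ s * word w := by simp [word]

theorem word_append (u v : List σ) : word (u ++ v) = word u * word v := by simp [word]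

theorem equivMonoidAlgebraFreeMonoid_word (w : List σ) :
    equivMonoidAlgebraFreeMonoid (word w) = MonoidAlgebra.single (FreeMonoid.ofList w) (1 : ℝ) := by
  induction w with
  | nil => simp [word, MonoidAlgebra.one_def]
  | cons s w ih =>
    rw [word_cons, map_mul, ih]
    simp [equivMonoidAlgebraFreeMonoid, MonoidAlgebra.of_apply, MonoidAlgebra.single_mul_single]

theorem equivMonoidAlgebraFreeMonoid_symm_single (w : FreeMonoid σ) (c : ℝ) :
    equivMonoidAlgebraFreeMonoid.symm (MonoidAlgebra.single w c) = c • word w.toList := by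
  rw [AlgEquiv.symm_apply_eq, map_smul, equivMonoidAlgebraFreeMonoid_word]
  simp

theorem wordCoeff_word [DecidableEq σ] (w u : List σ) :
    wordCoeff w (word u) = if u = w then 1 else 0 := by
  classical
  rw [wordCoeff_apply, equivMonoidAlgebraFreeMonoid_word, MonoidAlgebra.coeff_single, Finsupp.single_apply]
  simp

theorem ext_wordCoeff {p q : FreeAlgebra ℝ σ} (h : ∀ w, wordCoeff w p = wordCoeff w q) : p = q := by
  apply equivMonoidAlgebraFreeMonoid.injective
  ext w
  exact h w.toList

/-- Linear induction over words. -/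
theorem word_induction {motive : FreeAlgebra ℝ σ → Prop} (p : FreeAlgebra ℝ σ)
    (h_word : ∀ w, motive (word w)) (h_add : ∀ p q, motive p → motive q → motive (p + q))
    (h_smul : ∀ (c : ℝ) p, motive p → motive (c • p)) : motive p := by
  obtain ⟨x, rfl⟩ := (equivMonoidAlgebraFreeMonoid (R := ℝ) (X := σ)).symm.surjective p
  induction x using MonoidAlgebra.induction_linear with
  | zero => simpa using h_smul 0 _ (h_word [])
  | add x y hx hy => rw [map_add]; exact h_add _ _ hx hy
  | single m r =>
    rw [equivMonoidAlgebraFreeMonoid_symm_single]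
    exact h_smul _ _ (h_word _)

theorem finite_setOf_wordCoeff_ne_zero (p : FreeAlgebra ℝ σ) : {w | wordCoeff w p ≠ 0}.Finite :=
  (equivMonoidAlgebraFreeMonoid p).coeff.hasFiniteSupport

theorem exists_wordCoeff_eq (f : List σ → ℝ) (hf : {w | f w ≠ 0}.Finite) :
    ∃ p : FreeAlgebra ℝ σ, ∀ w, wordCoeff w p = f w := by
  refine ⟨equivMonoidAlgebraFreeMonoid.symm
    (.ofCoeff (Finsupp.ofSupportFinite (fun w : FreeMonoid σ => f w.toList) hf)), fun w => ?_⟩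
  rw [wordCoeff_apply, AlgEquiv.apply_symm_apply]
  rfl

theorem sum_wordCoeff_smul_word (p : FreeAlgebra ℝ σ) (s : Finset (List σ))
    (hs : ∀ w, wordCoeff w p ≠ 0 → w ∈ s) : ∑ w ∈ s, wordCoeff w p • word w = p := by
  classical
  refine ext_wordCoeff fun w => ?_
  simp only [map_sum, map_smul, wordCoeff_word, smul_eq_mul, mul_ite, mul_one, mul_zero,
    Finset.sum_ite_eq']
  split_ifs with h
  · rfl
  · by_contra h'
    exact h (hs w (Ne.symm h'))

theorem wordCoeff_mul (p q : FreeAlgebra ℝ σ) (w : List σ) :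
    wordCoeff w (p * q) =
      ∑ i ∈ Finset.range (w.length + 1), wordCoeff (w.take i) p * wordCoeff (w.drop i) q := by
  classical
  induction p using word_induction with
  | h_add p p' hp hp' => simp only [add_mul, map_add, hp, hp', Finset.sum_add_distrib]
  | h_smul c p hp =>
    simp only [smul_mul_assoc, map_smul, hp, smul_eq_mul, Finset.mul_sum, mul_assoc]
  | h_word u =>
    induction q using word_induction with
    | h_add p p' hp hp' => simp only [mul_add, map_add, hp, hp', Finset.sum_add_distrib]
    | h_smul c p hp =>
      simp only [mul_smul_comm, map_smul, hp, smul_eq_mul, Finset.mul_sum]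
      exact Finset.sum_congr rfl fun _ _ => by ring
    | h_word v =>
      rw [← word_append, wordCoeff_word]
      simp only [wordCoeff_word, ← ite_and, mul_ite, mul_one, mul_zero]
      split_ifs with h
      · subst h
        rw [Finset.sum_eq_single u.length]
        · simp
        · intro i hi hne
          rw [if_neg]
          rintro ⟨-, h⟩
          have := congrArg List.length h
          simp only [List.length_take, List.length_append, Finset.mem_range] at this hi
          omega
        · simp only [List.length_append, Finset.mem_range]
          intro h; omega
      · refine (Finset.sum_eq_zero fun i _ => if_neg ?_).symm
        rintro ⟨h1, h2⟩
        exact h (by rw [h1, h2, List.take_append_drop])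

theorem star_real_smul (c : ℝ) (p : FreeAlgebra ℝ σ) : star (c • p) = c • star p := by
  rw [Algebra.smul_def, star_mul, star_algebraMap, Algebra.smul_def, Algebra.commutes]

theorem star_word (w : List σ) : star (word w) = word w.reverse := by
  induction w with
  | nil => simp
  | cons s w ih => rw [word_cons, star_mul, ih, star_ι, List.reverse_cons, word_append]; simp [word]

theorem wordCoeff_star (p : FreeAlgebra ℝ σ) (w : List σ) :
    wordCoeff w (star p) = wordCoeff w.reverse p := by
  classical
  induction p using word_induction with
  | h_add p q hp hq => simp only [star_add, map_add, hp, hq]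
  | h_smul c p hp => simp only [star_real_smul, map_smul, hp]
  | h_word u =>
    simp only [star_word, wordCoeff_word, List.reverse_eq_iff]

theorem wordCoeff_sum_star_mul {κ : Type*} [Fintype κ] (P : κ → FreeAlgebra ℝ σ) (w : List σ) :
    wordCoeff w (∑ k, star (P k) * P k) = ∑ k, ∑ i ∈ Finset.range (w.length + 1),
      wordCoeff (w.take i).reverse (P k) * wordCoeff (w.drop i) (P k) := by
  simp only [map_sum, wordCoeff_mul, wordCoeff_star]

theorem lift_word {A : Type*} [Semiring A] [Algebra ℝ A] (Z : σ → A) (w : List σ) :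
    lift ℝ Z (word w) = (w.map Z).prod := by
  rw [word, map_list_prod, List.map_map]
  congr 2
  ext s
  simp

theorem wordCoeff_ι_mul [DecidableEq σ] (s t : σ) (p : FreeAlgebra ℝ σ) (w : List σ) :
    wordCoeff (t :: w) (ι ℝ s * p) = if s = t then wordCoeff w p else 0 := by
  induction p using word_induction with
  | h_add p q hp hq => simp only [mul_add, map_add, hp, hq]; split_ifs <;> simp
  | h_smul c p hp => simp only [mul_smul_comm, map_smul, hp]; split_ifs <;> simp
  | h_word u => rw [← word_cons, wordCoeff_word, wordCoeff_word]; simp [ite_and]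

theorem wordCoeff_nil_ι_mul (s : σ) (p : FreeAlgebra ℝ σ) :
    wordCoeff [] (ι ℝ s * p) = 0 := by
  classical
  induction p using word_induction with
  | h_add p q hp hq => simp only [mul_add, map_add, hp, hq, add_zero]
  | h_smul c p hp => simp only [mul_smul_comm, map_smul, hp, smul_zero]
  | h_word u => rw [← word_cons, wordCoeff_word]; simp

/-- Coefficients after replacing each letter by a weighted sum of the letters in a fibre. -/
theorem wordCoeff_lift_sum_fiber [Fintype τ] [DecidableEq σ] (π : τ → σ) (c : τ → ℝ)
    (p : FreeAlgebra ℝ σ) (w : List τ) :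
    wordCoeff w (lift ℝ (fun s => ∑ t with π t = s, c t • ι ℝ t) p) =
      (w.map c).prod * wordCoeff (w.map π) p := by
  classical
  induction p using word_induction with
  | h_add p q hp hq => simp only [map_add, hp, hq]; ring
  | h_smul a p hp => simp only [map_smul, hp, smul_eq_mul]; ring
  | h_word u =>
    induction u generalizing w with
    | nil =>
      rw [word_nil, map_one, ← word_nil, ← word_nil, wordCoeff_word, wordCoeff_word]
      cases w <;> simp
    | cons s u ih =>
      rw [word_cons, map_mul, lift_ι_apply, Finset.sum_mul, map_sum]
      cases w with
      | nil => simp [wordCoeff_nil_ι_mul]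
      | cons t w =>
        simp only [smul_mul_assoc, map_smul, wordCoeff_ι_mul, List.map_cons, List.prod_cons, ih,
          smul_eq_mul, mul_ite, mul_zero, Finset.sum_ite_eq', Finset.mem_filter, Finset.mem_univ,
          true_and, eq_comm (a := s)]
        split_ifs <;> ring

/-- A word that is extremal for an additive, reversal invariant weight among the words of the `P k`
contributes a square to the corresponding coefficient of `∑ k, star (P k) * P k`. -/
theorem exists_wordCoeff_sum_star_mul_pos {κ : Type*} [Fintype κ] (P : κ → FreeAlgebra ℝ σ)
    (φ : List σ → ℤ) (h_append : ∀ u v, φ (u ++ v) = φ u + φ v)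
    (h_reverse : ∀ u, φ u.reverse = φ u) {k : κ} {v : List σ} (hv : wordCoeff v (P k) ≠ 0) :
    ∃ u, φ v ≤ φ u ∧ 0 < wordCoeff (u.reverse ++ u) (∑ k, star (P k) * P k) := by
  classical
  have hfin : {w | ∃ k, wordCoeff w (P k) ≠ 0}.Finite := by
    have : {w | ∃ k, wordCoeff w (P k) ≠ 0} = ⋃ k, {w | wordCoeff w (P k) ≠ 0} := by
      ext w; simp
    rw [this]
    exact Set.finite_iUnion fun k => finite_setOf_wordCoeff_ne_zero (P k)
  obtain ⟨u₁, hu₁, hmax₁⟩ := Set.exists_max_image _ φ hfin ⟨v, k, hv⟩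
  -- Ties in `φ` are broken by length. If `uᵀu` is cut into two words of the family, maximality of
  -- `φ u` forces both pieces to have weight `φ u`. Then neither is longer than `u`, so the cut is
  -- in the middle and only squares contribute.
  obtain ⟨u, ⟨hu, hφ⟩, hmax₂⟩ := Set.exists_max_image
    ({w | ∃ k, wordCoeff w (P k) ≠ 0} ∩ {w | φ w = φ u₁}) List.length (hfin.inter_of_left _)
    ⟨u₁, hu₁, rfl⟩
  simp only [Set.mem_ofPred_eq] at hφ
  refine ⟨u, hφ ▸ hmax₁ v ⟨k, hv⟩, ?_⟩
  have key : wordCoeff (u.reverse ++ u) (∑ k, star (P k) * P k) =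
      ∑ k, wordCoeff u (P k) ^ 2 := by
    rw [wordCoeff_sum_star_mul]
    refine Finset.sum_congr rfl fun k _ => ?_
    rw [Finset.sum_eq_single u.length]
    · rw [List.take_left' (by simp), List.drop_left' (by simp), List.reverse_reverse, sq]
    · intro i hi hne
      by_contra h
      obtain ⟨h1, h2⟩ := mul_ne_zero_iff.mp h
      set x := ((u.reverse ++ u).take i) with hx
      set y := ((u.reverse ++ u).drop i) with hy
      have hxy : x ++ y = u.reverse ++ u := List.take_append_drop _ _
      have e1 : φ x + φ y = φ u + φ u := by
        rw [← h_append, hxy, h_append, h_reverse]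
      have b1 := hmax₁ _ ⟨k, h1⟩
      have b2 := hmax₁ _ ⟨k, h2⟩
      rw [h_reverse] at b1
      have c1 := hmax₂ x.reverse ⟨⟨k, h1⟩, by rw [Set.mem_ofPred_eq, h_reverse]; omega⟩
      have c2 := hmax₂ y ⟨⟨k, h2⟩, by rw [Set.mem_ofPred_eq]; omega⟩
      have l1 := congrArg List.length hxy
      have l2 : x.length = i := by
        rw [hx, List.length_take]
        have := Finset.mem_range.mp hi
        omega
      simp only [List.length_append, List.length_reverse] at l1 c1
      omega
    · intro h
      simp only [Finset.mem_range, List.length_append, List.length_reverse] at h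
      omega
  rw [key]
  obtain ⟨k', hk'⟩ := hu
  exact Finset.sum_pos' (fun _ _ => sq_nonneg _) ⟨k', Finset.mem_univ _, by positivity⟩

/-- A word of `∑ k, star (P k) * P k` splits into two words of some `P k`. -/
theorem exists_append_of_wordCoeff_sum_star_mul_ne_zero {κ : Type*} [Fintype κ]
    {P : κ → FreeAlgebra ℝ σ} {w : List σ} (hw : wordCoeff w (∑ k, star (P k) * P k) ≠ 0) :
    ∃ k u v, u ++ v = w ∧ wordCoeff u.reverse (P k) ≠ 0 ∧ wordCoeff v (P k) ≠ 0 := by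
  rw [wordCoeff_sum_star_mul] at hw
  obtain ⟨k, -, hk⟩ := Finset.exists_ne_zero_of_sum_ne_zero hw
  obtain ⟨i, -, hi⟩ := Finset.exists_ne_zero_of_sum_ne_zero hk
  obtain ⟨h1, h2⟩ := mul_ne_zero_iff.mp hi
  exact ⟨k, _, _, List.take_append_drop i w, h1, h2⟩

end FreeAlgebra

/-! ### Closed cones and positive semidefinite matrices. -/

/-- The image of a closed cone under a linear map that is injective at `0` on the cone is closed. -/
theorem LinearMap.isClosed_image_of_isClosed_cone {E F : Type*} [NormedAddCommGroup E]
    [NormedSpace ℝ E] [FiniteDimensional ℝ E] [NormedAddCommGroup F] [NormedSpace ℝ F]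
    (T : E →ₗ[ℝ] F) {K : Set E} (hK : IsClosed K) (h_smul : ∀ c : ℝ, 0 ≤ c → ∀ x ∈ K, c • x ∈ K)
    (h_ker : ∀ x ∈ K, T x = 0 → x = 0) : IsClosed (T '' K) := by
  have hT : Continuous T := T.continuous_of_finiteDimensional
  -- `‖T x‖` attains a positive minimum on the compact unit section of the cone, and homogeneity
  -- extends the bound. Consequently, image points near a given `y` come from a bounded part of the
  -- cone.
  obtain ⟨m, hm, hbound⟩ : ∃ m > 0, ∀ x ∈ K, m * ‖x‖ ≤ ‖T x‖ := by
    have hcomp : IsCompact (K ∩ Metric.sphere (0 : E) 1) := by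
      have := FiniteDimensional.proper_real E
      exact (isCompact_sphere (0 : E) 1).inter_left hK
    rcases (K ∩ Metric.sphere (0 : E) 1).eq_empty_or_nonempty with hemp | hne
    · refine ⟨1, one_pos, fun x hx => ?_⟩
      by_cases hx0 : x = 0
      · simp [hx0]
      · exfalso
        have : ‖x‖⁻¹ • x ∈ K ∩ Metric.sphere (0 : E) 1 :=
          ⟨h_smul _ (by positivity) x hx, by simp [norm_smul, hx0]⟩
        rw [hemp] at this
        exact this
    · obtain ⟨x₀, ⟨hx₀K, hx₀s⟩, hmin⟩ := hcomp.exists_isMinOn hne (hT.norm.continuousOn)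
      refine ⟨‖T x₀‖, ?_, fun x hx => ?_⟩
      · refine norm_pos_iff.mpr fun h => ?_
        have := h_ker x₀ hx₀K h
        simp [this] at hx₀s
      · by_cases hx0 : x = 0
        · simp [hx0]
        · have hpos : 0 < ‖x‖ := norm_pos_iff.mpr hx0
          have hmem : ‖x‖⁻¹ • x ∈ K ∩ Metric.sphere (0 : E) 1 :=
            ⟨h_smul _ (by positivity) x hx, by simp [norm_smul, hx0]⟩
          have h : ‖T x₀‖ ≤ ‖T (‖x‖⁻¹ • x)‖ := hmin hmem
          rw [map_smul, norm_smul, norm_inv, norm_norm, inv_mul_eq_div, le_div_iff₀ hpos] at h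
          exact h
  refine isClosed_of_closure_subset fun y hy => ?_
  have := FiniteDimensional.proper_real E
  have hcpt : IsCompact (T '' (K ∩ Metric.closedBall 0 ((‖y‖ + 1) / m))) :=
    ((isCompact_closedBall _ _).inter_left hK).image hT
  have hsub : T '' K ∩ Metric.ball y 1 ⊆ T '' (K ∩ Metric.closedBall 0 ((‖y‖ + 1) / m)) := by
    rintro _ ⟨⟨x, hx, rfl⟩, hxy⟩
    refine ⟨x, ⟨hx, ?_⟩, rfl⟩
    rw [mem_closedBall_zero_iff, le_div_iff₀ hm, mul_comm]
    refine (hbound x hx).trans ?_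
    have h1 : ‖T x - y‖ < 1 := mem_ball_iff_norm.mp hxy
    have h2 := norm_le_norm_add_norm_sub' (T x) y
    linarith
  have hy' : y ∈ closure (T '' K ∩ Metric.ball y 1) := by
    rw [Set.inter_comm]
    exact Metric.isOpen_ball.inter_closure ⟨Metric.mem_ball_self one_pos, hy⟩
  have hy2 : y ∈ T '' (K ∩ Metric.closedBall 0 ((‖y‖ + 1) / m)) :=
    hcpt.isClosed.closure_subset_iff.mpr hsub hy'
  exact Set.image_mono Set.inter_subset_left hy2

namespace Matrix

theorem PosSemidef.exists_eq_transpose_mul_self {n : Type*} [Fintype n]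
    {G : Matrix n n ℝ} (hG : G.PosSemidef) : ∃ B : Matrix n n ℝ, G = Bᵀ * B := by
  classical
  open scoped MatrixOrder in
  open scoped Matrix.Norms.L2Operator in
  obtain ⟨B, hB⟩ := CStarAlgebra.nonneg_iff_eq_star_mul_self.mp hG.nonneg
  exact ⟨B, by rw [hB, star_eq_conjTranspose, conjTranspose_eq_transpose_of_trivial]⟩

theorem isClosed_setOf_posSemidef {n : Type*} [Fintype n] :
    IsClosed {G : Matrix n n ℝ | G.PosSemidef} := by
  simp only [posSemidef_iff_dotProduct_mulVec, Set.ofPred_and, Set.ofPred_forall]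
  refine IsClosed.inter ?_ (isClosed_iInter fun x => ?_)
  · exact isClosed_eq (by fun_prop) continuous_id
  · exact isClosed_le continuous_const (by fun_prop)

theorem convex_setOf_posSemidef {n : Type*} [Fintype n] :
    Convex ℝ {G : Matrix n n ℝ | G.PosSemidef} := by
  intro A hA B hB a b ha hb _
  exact (hA.smul ha).add (hB.smul hb)

end Matrix

/-! ### Hankel matrices and the truncated GNS construction. -/

namespace FreeAlgebra

open Matrix

variable {σ : Type*}

/-- Words of length at most `d`. -/
abbrev BoundedWord (σ : Type*) (d : ℕ) : Type _ := {w : List σ // w.length ≤ d}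

noncomputable instance [Finite σ] (d : ℕ) : Fintype (BoundedWord σ d) :=
  @Fintype.ofFinite _ (List.finite_length_le σ d).to_subtype

/-- The empty word. -/
def BoundedWord.nil (σ : Type*) (d : ℕ) : BoundedWord σ d := ⟨[], Nat.zero_le d⟩

/-- The Hankel matrix of a function on words. -/
def hankel (l : List σ → ℝ) (d : ℕ) : Matrix (BoundedWord σ d) (BoundedWord σ d) ℝ :=
  Matrix.of fun u v => l (u.1.reverse ++ v.1)

theorem prod_map_reverse_of_isSymm {n : Type*} [Fintype n] [DecidableEq n] {Z : σ → Matrix n n ℝ}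
    (hZ : ∀ s, (Z s).IsSymm) (w : List σ) : (w.reverse.map Z).prod = (w.map Z).prodᵀ := by
  rw [Matrix.transpose_list_prod, List.map_map, List.map_reverse]
  congr 3
  ext s : 1
  exact (hZ s).eq.symm

theorem dotProduct_prod_map_append {n : Type*} [Fintype n] [DecidableEq n] {Z : σ → Matrix n n ℝ}
    (hZ : ∀ s, (Z s).IsSymm) (u v : List σ) (x : n → ℝ) :
    x ⬝ᵥ (((u.reverse ++ v).map Z).prod *ᵥ x) =
      ((u.map Z).prod *ᵥ x) ⬝ᵥ ((v.map Z).prod *ᵥ x) := by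
  rw [List.map_append, List.prod_append, prod_map_reverse_of_isSymm hZ, ← mulVec_mulVec,
    dotProduct_mulVec, vecMul_transpose]

/-- The symmetrized truncated shift by a letter on `ℝ^(BoundedWord σ d)`. -/
def shiftMatrix (σ : Type*) [DecidableEq σ] (d : ℕ) (s : σ) :
    Matrix (BoundedWord σ d) (BoundedWord σ d) ℝ :=
  Matrix.of fun u v => if u.1 = s :: v.1 ∨ v.1 = s :: u.1 then 1 else 0

theorem shiftMatrix_isSymm [DecidableEq σ] (d : ℕ) (s : σ) : (shiftMatrix σ d s).IsSymm := by
  ext u v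
  simp [shiftMatrix, or_comm]

/-- Each letter creates or annihilates itself at the front of a word. Starting from the empty word,
`u` therefore reaches no word longer than itself, and reaches length `u.length` only by creating
every letter. -/
theorem prod_shiftMatrix_mulVec_apply [Finite σ] [DecidableEq σ] (d : ℕ) (u : List σ) (v : BoundedWord σ d)
    (h : u.length ≤ v.1.length) :
    ((u.map (shiftMatrix σ d)).prod *ᵥ Pi.single (BoundedWord.nil σ d) 1) v =
      if u = v.1 then 1 else 0 := by
  induction u generalizing v with
  | nil =>
    simp only [List.map_nil, List.prod_nil, one_mulVec, Pi.single_apply, Subtype.ext_iff,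
      BoundedWord.nil, eq_comm]
  | cons s u ih =>
    rw [List.map_cons, List.prod_cons, ← mulVec_mulVec, mulVec, dotProduct]
    simp only [List.length_cons] at h
    have hterm : ∀ v' : BoundedWord σ d, shiftMatrix σ d s v v' *
        ((u.map (shiftMatrix σ d)).prod *ᵥ Pi.single (BoundedWord.nil σ d) 1) v' =
        if v.1 = s :: u ∧ v'.1 = u then 1 else 0 := by
      intro v'
      simp only [shiftMatrix, of_apply]
      by_cases h1 : v.1 = s :: v'.1
      · rw [if_pos (Or.inl h1), ih v' (by rw [h1, List.length_cons] at h; omega), one_mul, h1]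
        by_cases h2 : u = v'.1
        · simp [h2]
        · rw [if_neg h2, if_neg fun h3 => h2 h3.2.symm]
      · rw [if_neg (c := v.1 = s :: u ∧ v'.1 = u) fun h3 => h1 (by rw [h3.2, h3.1])]
        by_cases h2 : v'.1 = s :: v.1
        · have h3 : v'.1.length = v.1.length + 1 := by rw [h2, List.length_cons]
          rw [ih v' (by omega), if_neg (c := u = v'.1), mul_zero]
          rintro rfl
          omega
        · rw [if_neg (by tauto), zero_mul]
    rw [Finset.sum_congr rfl fun v' _ => hterm v']
    by_cases h1 : v.1 = s :: u
    · have hu : u.length ≤ d := by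
        have := v.2
        rw [h1, List.length_cons] at this
        omega
      rw [Finset.sum_eq_single ⟨u, hu⟩]
      · simp [h1]
      · intro b _ hb
        rw [if_neg]
        rintro ⟨-, h2⟩
        exact hb (Subtype.ext h2)
      · simp
    · rw [if_neg (c := s :: u = v.1) (fun h => h1 h.symm)]
      exact Finset.sum_eq_zero fun _ _ => if_neg fun h => h1 h.1

/-- There is a reversal invariant function on words with a positive definite Hankel matrix. -/
theorem exists_hankel_posDef (σ : Type*) [Finite σ] (d : ℕ) :
    ∃ l : List σ → ℝ, (∀ w, l w.reverse = l w) ∧ (hankel l d).PosDef := by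
  classical
  set e : BoundedWord σ d → ℝ := Pi.single (BoundedWord.nil σ d) 1 with he
  set l : List σ → ℝ := fun w => e ⬝ᵥ ((w.map (shiftMatrix σ d)).prod *ᵥ e) with hl
  set Y : Matrix (BoundedWord σ d) (BoundedWord σ d) ℝ :=
    Matrix.of fun a u => ((u.1.map (shiftMatrix σ d)).prod *ᵥ e) a with hY
  have hH : hankel l d = Yᴴ * Y := by
    ext u v
    rw [hankel, of_apply, hl]
    simp only
    rw [dotProduct_prod_map_append (shiftMatrix_isSymm d)]
    simp [hY, mul_apply, dotProduct]
  refine ⟨l, fun w => ?_, ?_⟩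
  · simp only [hl]
    rw [prod_map_reverse_of_isSymm (shiftMatrix_isSymm d), mulVec_transpose, dotProduct_comm,
      dotProduct_mulVec]
  · rw [hH]
    apply PosDef.conjTranspose_mul_self
    rw [← coe_mulVecLin, ← LinearMap.ker_eq_bot, LinearMap.ker_eq_bot']
    intro x hx
    by_contra hne
    obtain ⟨v₀, hv₀⟩ := Function.ne_iff.mp hne
    -- `Y` is unitriangular with respect to length: at a longest word `v` in the support of `x`, row
    -- `v` of `Y *ᵥ x = 0` reads `x v = 0`.
    obtain ⟨v, hv, hmax⟩ := Finset.exists_max_image (Finset.univ.filter fun v => x v ≠ 0)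
      (fun v => v.1.length) ⟨v₀, by simpa using hv₀⟩
    simp only [Finset.mem_filter, Finset.mem_univ, true_and] at hv hmax
    have h := congrFun hx v
    rw [coe_mulVecLin, mulVec, dotProduct, Finset.sum_eq_single v] at h
    · simp only [hY, of_apply, he] at h
      rw [prod_shiftMatrix_mulVec_apply d _ _ le_rfl, if_pos rfl, one_mul] at h
      exact hv h
    · intro u _ hu
      by_cases hxu : x u = 0
      · rw [hxu, mul_zero]
      · simp only [hY, of_apply, he]
        rw [prod_shiftMatrix_mulVec_apply d _ _ (hmax u hxu), if_neg, zero_mul]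
        exact fun h => hu (Subtype.ext h)
    · simp

/-- Truncated Gelfand–Naimark–Segal construction: a function on words with a positive definite
Hankel matrix is a vector state of a tuple of symmetric matrices, up to twice the order. -/
theorem exists_isSymm_of_hankel_posDef [Finite σ] [DecidableEq σ] {d : ℕ} {l : List σ → ℝ}
    (h_reverse : ∀ w, l w.reverse = l w)
    (hH : (hankel l d).PosDef) :
    ∃ (Z : σ → Matrix (BoundedWord σ d) (BoundedWord σ d) ℝ) (x : BoundedWord σ d → ℝ),
      (∀ s, (Z s).IsSymm) ∧ ∀ w : List σ, w.length ≤ 2 * d →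
        x ⬝ᵥ ((w.map Z).prod *ᵥ x) = l w := by
  obtain ⟨B, hB⟩ := hH.posSemidef.exists_eq_transpose_mul_self
  have hBdet : IsUnit B.det := by
    have h := hH.det_pos
    rw [hB, det_mul, det_transpose] at h
    exact isUnit_iff_ne_zero.mpr fun h0 => by simp [h0] at h
  have hBTdet : IsUnit Bᵀ.det := by rwa [det_transpose]
  -- The form of left multiplication by `s`. The default `0` concerns only `u` and `v` both of
  -- length `d`; it is harmless, since only columns with `v.length < d` are evaluated.
  set S : σ → Matrix (BoundedWord σ d) (BoundedWord σ d) ℝ := fun s => Matrix.of fun u v =>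
    if u.1.length + v.1.length + 1 ≤ 2 * d then l (u.1.reverse ++ s :: v.1) else 0 with hS
  set x : BoundedWord σ d → ℝ := B *ᵥ Pi.single (BoundedWord.nil σ d) 1 with hx
  -- Conjugation by `B` turns the Hankel inner product into the standard one, with `B *ᵥ Pi.single v
  -- 1` representing the word `v`.
  set Z : σ → Matrix (BoundedWord σ d) (BoundedWord σ d) ℝ :=
    fun s => Bᵀ⁻¹ * S s * B⁻¹ with hZdef
  have hSsymm : ∀ s, (S s)ᵀ = S s := by
    intro s
    ext u v
    simp only [hS, transpose_apply, of_apply, add_comm v.1.length]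
    congr 1
    rw [← h_reverse]
    simp
  have hZ : ∀ s, (Z s).IsSymm := by
    intro s
    simp only [hZdef, Matrix.IsSymm, transpose_mul, transpose_nonsing_inv, hSsymm,
      transpose_transpose, Matrix.mul_assoc]
  have hword : ∀ v : List σ, ∀ hv : v.length ≤ d,
      (v.map Z).prod *ᵥ x = B *ᵥ Pi.single ⟨v, hv⟩ 1 := by
    intro v
    induction v with
    | nil => intro hv; simp [hx, BoundedWord.nil]
    | cons s v ih =>
      intro hv
      have hv' : v.length < d := by simpa using hv
      have hcol : S s *ᵥ Pi.single ⟨v, hv'.le⟩ 1 = hankel l d *ᵥ Pi.single ⟨s :: v, hv⟩ 1 := by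
        ext u
        simp only [mulVec_single_one, hS, hankel, col_apply, of_apply]
        rw [if_pos]
        have := u.2
        omega
      rw [List.map_cons, List.prod_cons, ← mulVec_mulVec, ih hv'.le, hZdef]
      simp only [mulVec_mulVec, Matrix.mul_assoc, nonsing_inv_mul _ hBdet, Matrix.mul_one]
      rw [← mulVec_mulVec, hcol, hB, mulVec_mulVec, ← Matrix.mul_assoc, nonsing_inv_mul _ hBTdet,
        Matrix.one_mul]
  refine ⟨Z, x, hZ, fun w hw => ?_⟩
  have hu : (w.take d).reverse.length ≤ d := by simp
  have hv : (w.drop d).length ≤ d := by simp; omega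
  have hsplit : (w.take d).reverse.reverse ++ w.drop d = w := by simp
  conv_lhs => rw [← hsplit]
  rw [dotProduct_prod_map_append hZ, hword _ hu, hword _ hv, dotProduct_mulVec, ← mulVec_transpose,
    mulVec_mulVec, ← hB]
  simp only [hankel, mulVec_single_one, dotProduct_single_one, col_apply, of_apply]
  rw [← List.reverse_append, List.take_append_drop, h_reverse]

end FreeAlgebra

/-! ### Gram matrices and Helton's theorem. -/

namespace FreeAlgebra

open Matrix

variable {σ : Type*}

/-- The coefficients of the polynomial with a given Gram matrix. -/
noncomputable def gramCoeff (σ : Type*) [Finite σ] [DecidableEq σ] (d : ℕ) :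
    Matrix (BoundedWord σ d) (BoundedWord σ d) ℝ →ₗ[ℝ] (BoundedWord σ (2 * d) → ℝ) where
  toFun G w := ∑ u, ∑ v, if u.1.reverse ++ v.1 = w.1 then G u v else 0
  map_add' G G' := by
    ext w
    simp only [Matrix.add_apply, Pi.add_apply, ← Finset.sum_add_distrib]
    exact Finset.sum_congr rfl fun u _ => Finset.sum_congr rfl fun v _ => by split_ifs <;> simp
  map_smul' c G := by
    ext w
    simp only [Matrix.smul_apply, Pi.smul_apply, smul_eq_mul, RingHom.id_apply, Finset.mul_sum]
    exact Finset.sum_congr rfl fun u _ => Finset.sum_congr rfl fun v _ => by split_ifs <;> simp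

theorem gramCoeff_apply [Finite σ] [DecidableEq σ] (d : ℕ)
    (G : Matrix (BoundedWord σ d) (BoundedWord σ d) ℝ) (w : BoundedWord σ (2 * d)) :
    gramCoeff σ d G w = ∑ u, ∑ v, if u.1.reverse ++ v.1 = w.1 then G u v else 0 := rfl

/-- The polynomial whose coefficients are a row of a matrix. -/
noncomputable def rowPoly [Finite σ] {d : ℕ} (B : Matrix (BoundedWord σ d) (BoundedWord σ d) ℝ)
    (k : BoundedWord σ d) : FreeAlgebra ℝ σ := ∑ u, B k u • word u.1

theorem wordCoeff_rowPoly [Finite σ] {d : ℕ} (B : Matrix (BoundedWord σ d) (BoundedWord σ d) ℝ)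
    (k u : BoundedWord σ d) : wordCoeff u.1 (rowPoly B k) = B k u := by
  classical
  simp [rowPoly, wordCoeff_word, ← Subtype.ext_iff]

theorem wordCoeff_sum_star_mul_rowPoly [Finite σ] [DecidableEq σ] {d : ℕ}
    (B : Matrix (BoundedWord σ d) (BoundedWord σ d) ℝ) (w : List σ) :
    wordCoeff w (∑ k, star (rowPoly B k) * rowPoly B k) =
      ∑ u : BoundedWord σ d, ∑ v : BoundedWord σ d,
        if u.1.reverse ++ v.1 = w then (Bᵀ * B) u v else 0 := by
  simp only [rowPoly, star_sum, star_real_smul, star_word, Finset.sum_mul_sum, smul_mul_smul_comm,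
    ← word_append, map_sum, map_smul, wordCoeff_word, smul_eq_mul, mul_ite, mul_one, mul_zero]
  rw [Finset.sum_comm]
  refine Finset.sum_congr rfl fun u _ => ?_
  rw [Finset.sum_comm]
  refine Finset.sum_congr rfl fun v _ => ?_
  split_ifs
  · simp [Matrix.mul_apply]
  · simp

theorem eq_sum_star_mul_rowPoly [Finite σ] [DecidableEq σ] {d : ℕ} {q : FreeAlgebra ℝ σ}
    (hq : ∀ w, wordCoeff w q ≠ 0 → w.length ≤ 2 * d)
    {B : Matrix (BoundedWord σ d) (BoundedWord σ d) ℝ}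
    (hB : gramCoeff σ d (Bᵀ * B) = fun w => wordCoeff w.1 q) :
    q = ∑ k, star (rowPoly B k) * rowPoly B k := by
  refine ext_wordCoeff fun w => ?_
  rw [wordCoeff_sum_star_mul_rowPoly]
  by_cases hw : w.length ≤ 2 * d
  · have h := congrFun hB ⟨w, hw⟩
    rw [gramCoeff_apply] at h
    exact h.symm
  · have h0 : wordCoeff w q = 0 := by
      by_contra h
      exact hw (hq w h)
    rw [h0]
    refine (Finset.sum_eq_zero fun u _ => Finset.sum_eq_zero fun v _ => if_neg ?_).symm
    rintro rfl
    have := u.2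
    have := v.2
    simp only [List.length_append, List.length_reverse] at hw
    omega

/-- Squares cannot cancel: a longest word among the rows of `B` would leave a positive coefficient.
This is the injectivity that makes the cone of sums of squares closed. -/
theorem eq_zero_of_gramCoeff_eq_zero [Finite σ] [DecidableEq σ] {d : ℕ}
    {G : Matrix (BoundedWord σ d) (BoundedWord σ d) ℝ} (hG : G.PosSemidef)
    (h : gramCoeff σ d G = 0) : G = 0 := by
  obtain ⟨B, rfl⟩ := hG.exists_eq_transpose_mul_self
  have h0 : (0 : FreeAlgebra ℝ σ) = ∑ k, star (rowPoly B k) * rowPoly B k :=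
    eq_sum_star_mul_rowPoly (d := d) (by simp) (by rw [h]; ext; simp)
  have hB : B = 0 := by
    ext k u
    by_contra hku
    have hku : wordCoeff u.1 (rowPoly B k) ≠ 0 := by rwa [wordCoeff_rowPoly]
    obtain ⟨u', -, hu'⟩ := exists_wordCoeff_sum_star_mul_pos (rowPoly B) (fun _ => 0)
      (by simp) (by simp) hku
    rw [← h0, map_zero] at hu'
    exact lt_irrefl _ hu'
  simp [hB]

theorem isClosed_gramCoeff_image [Finite σ] [DecidableEq σ] (d : ℕ) :
    IsClosed (gramCoeff σ d '' {G | G.PosSemidef}) := by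
  open scoped Matrix.Norms.Elementwise in
  exact (gramCoeff σ d).isClosed_image_of_isClosed_cone Matrix.isClosed_setOf_posSemidef
    (fun c hc G hG => PosSemidef.smul hG hc) (fun G hG h => eq_zero_of_gramCoeff_eq_zero hG h)

/-- A polynomial that is not a sum of squares is separated from the squares by a reversal invariant
function on words. -/
theorem exists_separating [Finite σ] [DecidableEq σ] {d : ℕ} {q : FreeAlgebra ℝ σ}
    (hstar : star q = q)
    (hq : (fun w : BoundedWord σ (2 * d) => wordCoeff w.1 q) ∉
      gramCoeff σ d '' {G | G.PosSemidef}) :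
    ∃ l : List σ → ℝ, (∀ w, l w.reverse = l w) ∧ (hankel l d).PosSemidef ∧
      ∑ w : BoundedWord σ (2 * d), wordCoeff w.1 q * l w.1 < 0 := by
  obtain ⟨f, b, hfq, hfC⟩ := geometric_hahn_banach_point_closed
    (Matrix.convex_setOf_posSemidef.linear_image (gramCoeff σ d)) (isClosed_gramCoeff_image d) hq
  have hb : b < 0 := by
    have := hfC _ ⟨0, PosSemidef.zero, rfl⟩
    simpa using this
  have hnonneg : ∀ G : Matrix (BoundedWord σ d) (BoundedWord σ d) ℝ, G.PosSemidef →
      0 ≤ f (gramCoeff σ d G) := by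
    intro G hG
    by_contra! hneg
    -- The rescaling gives `f` exactly the value `b` at a point of the cone, against the strict
    -- separation.
    have := hfC _ ⟨(b / f (gramCoeff σ d G)) • G,
      PosSemidef.smul hG (div_nonneg_of_nonpos hb.le hneg.le), rfl⟩
    rw [map_smul, map_smul, smul_eq_mul, div_mul_cancel₀ _ hneg.ne] at this
    exact lt_irrefl _ this
  set m : List σ → ℝ := fun w => if h : w.length ≤ 2 * d then f (Pi.single ⟨w, h⟩ 1) else 0 with hm
  have hf : ∀ y, f y = ∑ w, y w * m w.1 := by
    intro y
    conv_lhs => rw [← Finset.univ_sum_single y, map_sum]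
    refine Finset.sum_congr rfl fun w _ => ?_
    have : (Pi.single w (y w) : BoundedWord σ (2 * d) → ℝ) = y w • Pi.single w 1 := by
      rw [← Pi.single_smul, smul_eq_mul, mul_one]
    rw [this, map_smul, smul_eq_mul, hm]
    simp only [dif_pos w.2]
  have hfG : ∀ G, f (gramCoeff σ d G) = ∑ u, ∑ v, G u v * m (u.1.reverse ++ v.1) := by
    intro G
    rw [hf]
    simp only [gramCoeff_apply, Finset.sum_mul]
    rw [Finset.sum_comm]
    refine Finset.sum_congr rfl fun u _ => ?_
    rw [Finset.sum_comm]
    refine Finset.sum_congr rfl fun v _ => ?_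
    have hlen : (u.1.reverse ++ v.1).length ≤ 2 * d := by
      have := u.2
      have := v.2
      simp only [List.length_append, List.length_reverse]
      omega
    rw [Finset.sum_eq_single ⟨_, hlen⟩]
    · simp
    · intro w _ hw
      rw [if_neg, zero_mul]
      exact fun h => hw (Subtype.ext h.symm)
    · simp
  -- Symmetrizing under reversal changes neither the value at `q`, which is symmetric, nor the
  -- pairing with the symmetric matrices `x xᵀ`.
  refine ⟨fun w => (m w + m w.reverse) / 2, fun w => ?_, ?_, ?_⟩
  · simp only [List.reverse_reverse]
    ring
  · refine PosSemidef.of_dotProduct_mulVec_nonneg ?_ fun x => ?_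
    · ext u v
      simp [hankel, add_comm]
    · have h := hnonneg (vecMulVec x (star x)) (posSemidef_vecMulVec_self_star x)
      rw [hfG] at h
      have h' : ∑ u : BoundedWord σ d, ∑ v : BoundedWord σ d,
          vecMulVec x (star x) u v * m (v.1.reverse ++ u.1) =
          ∑ u : BoundedWord σ d, ∑ v : BoundedWord σ d,
          vecMulVec x (star x) u v * m (u.1.reverse ++ v.1) := by
        rw [Finset.sum_comm]
        refine Finset.sum_congr rfl fun u _ => Finset.sum_congr rfl fun v _ => ?_
        simp [vecMulVec_apply, mul_comm]
      have h2 : star x ⬝ᵥ hankel (fun w => (m w + m w.reverse) / 2) d *ᵥ x =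
          (∑ u : BoundedWord σ d, ∑ v : BoundedWord σ d,
            vecMulVec x (star x) u v * m (u.1.reverse ++ v.1) +
          ∑ u : BoundedWord σ d, ∑ v : BoundedWord σ d,
            vecMulVec x (star x) u v * m (v.1.reverse ++ u.1)) / 2 := by
        simp only [dotProduct, mulVec, hankel, of_apply, vecMulVec_apply, Pi.star_apply,
          star_trivial, List.reverse_append, List.reverse_reverse, Finset.mul_sum,
          ← Finset.sum_add_distrib, Finset.sum_div]
        exact Finset.sum_congr rfl fun u _ => Finset.sum_congr rfl fun v _ => by ring
      rw [h2, h']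
      linarith
  · have h1 : ∑ w : BoundedWord σ (2 * d), wordCoeff w.1 q * m w.1.reverse =
        ∑ w : BoundedWord σ (2 * d), wordCoeff w.1 q * m w.1 := by
      let e : BoundedWord σ (2 * d) ≃ BoundedWord σ (2 * d) :=
        ⟨fun w => ⟨w.1.reverse, by simpa using w.2⟩, fun w => ⟨w.1.reverse, by simpa using w.2⟩,
          fun w => by simp, fun w => by simp⟩
      rw [← Equiv.sum_comp e]
      refine Finset.sum_congr rfl fun w _ => ?_
      simp only [e, Equiv.coe_fn_mk, List.reverse_reverse]
      rw [← wordCoeff_star, hstar]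
    have h2 : ∑ w : BoundedWord σ (2 * d), wordCoeff w.1 q * ((m w.1 + m w.1.reverse) / 2) =
        (∑ w : BoundedWord σ (2 * d), wordCoeff w.1 q * m w.1 +
          ∑ w : BoundedWord σ (2 * d), wordCoeff w.1 q * m w.1.reverse) / 2 := by
      rw [← Finset.sum_add_distrib, Finset.sum_div]
      exact Finset.sum_congr rfl fun w _ => by ring
    rw [h2, h1]
    rw [hf] at hfq
    linarith

/-- Positivity on tuples of symmetric matrices indexed by an arbitrary finite type. -/
theorem posSemidef_lift_of_forall_fin {q : FreeAlgebra ℝ σ}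
    (hpos : ∀ (n : ℕ) (Z : σ → Matrix (Fin n) (Fin n) ℝ), (∀ s, (Z s).IsSymm) →
      (lift ℝ Z q).PosSemidef)
    {m : Type*} [Fintype m] [DecidableEq m] (Z : σ → Matrix m m ℝ) (hZ : ∀ s, (Z s).IsSymm) :
    (lift ℝ Z q).PosSemidef := by
  let e := Fintype.equivFin m
  have h := hpos _ (fun s => reindexAlgEquiv ℝ ℝ e (Z s)) fun s => by
    rw [Matrix.coe_reindexAlgEquiv, Matrix.IsSymm, transpose_reindex, (hZ s).eq]
  have h2 : lift ℝ (fun s => reindexAlgEquiv ℝ ℝ e (Z s)) q = reindexAlgEquiv ℝ ℝ e (lift ℝ Z q) := by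
    have : lift ℝ (fun s => reindexAlgEquiv ℝ ℝ e (Z s)) =
        (reindexAlgEquiv ℝ ℝ e).toAlgHom.comp (lift ℝ Z) := by
      refine hom_ext (funext fun s => ?_)
      simp
    rw [this]
    rfl
  rw [h2, Matrix.coe_reindexAlgEquiv, reindex_apply] at h
  exact (posSemidef_submatrix_equiv e.symm).mp h

/-- **Helton's theorem**: a noncommutative polynomial that is positive semidefinite on all tuples of
symmetric matrices is a sum of hermitian squares. -/
theorem exists_eq_sum_star_mul_of_posSemidef [Finite σ] {q : FreeAlgebra ℝ σ} (hstar : star q = q)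
    (hpos : ∀ (n : ℕ) (Z : σ → Matrix (Fin n) (Fin n) ℝ), (∀ s, (Z s).IsSymm) →
      (lift ℝ Z q).PosSemidef) :
    ∃ (m : ℕ) (P : Fin m → FreeAlgebra ℝ σ), q = ∑ k, star (P k) * P k := by
  classical
  obtain ⟨d, hd⟩ : ∃ d, ∀ w, wordCoeff w q ≠ 0 → w.length ≤ 2 * d := by
    obtain ⟨d, hd⟩ := ((finite_setOf_wordCoeff_ne_zero q).image List.length).bddAbove
    exact ⟨d, fun w hw => (hd ⟨w, hw, rfl⟩).trans (by omega)⟩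
  suffices h : (fun w : BoundedWord σ (2 * d) => wordCoeff w.1 q) ∈
      gramCoeff σ d '' {G | G.PosSemidef} by
    obtain ⟨G, hG, hGq⟩ := h
    obtain ⟨B, rfl⟩ := PosSemidef.exists_eq_transpose_mul_self hG
    refine ⟨Fintype.card (BoundedWord σ d),
      fun k => rowPoly B ((Fintype.equivFin (BoundedWord σ d)).symm k), ?_⟩
    rw [eq_sum_star_mul_rowPoly hd hGq]
    exact (Equiv.sum_comp (Fintype.equivFin (BoundedWord σ d)).symm
      fun k => star (rowPoly B k) * rowPoly B k).symm
  by_contra hnot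
  obtain ⟨l, hl, hlH, hlq⟩ := exists_separating hstar hnot
  obtain ⟨l₀, hl₀, hl₀H⟩ := exists_hankel_posDef σ d
  have key : ∀ ε : ℝ, 0 < ε → 0 ≤ ∑ w : BoundedWord σ (2 * d), wordCoeff w.1 q * l w.1 +
      ε * ∑ w : BoundedWord σ (2 * d), wordCoeff w.1 q * l₀ w.1 := by
    intro ε hε
    have hH : (hankel (fun w => l w + ε * l₀ w) d).PosDef := by
      have : hankel (fun w => l w + ε * l₀ w) d = hankel l d + ε • hankel l₀ d := by
        ext u v
        simp [hankel]
      rw [this]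
      exact PosDef.posSemidef_add hlH (hl₀H.smul hε)
    obtain ⟨Z, x, hZ, hx⟩ := exists_isSymm_of_hankel_posDef
      (fun w => by rw [hl, hl₀]) hH
    have hq := (posSemidef_lift_of_forall_fin hpos Z hZ).dotProduct_mulVec_nonneg x
    have hqsum : q = ∑ w : BoundedWord σ (2 * d), wordCoeff w.1 q • word w.1 := by
      conv_lhs => rw [← sum_wordCoeff_smul_word q
        ((Finset.univ : Finset (BoundedWord σ (2 * d))).map (Function.Embedding.subtype _))
        (fun w hw => by simpa using hd w hw), Finset.sum_map]
      rfl
    rw [hqsum, map_sum, star_trivial, sum_mulVec, dotProduct_sum] at hq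
    rw [Finset.mul_sum, ← Finset.sum_add_distrib]
    refine hq.trans_eq (Finset.sum_congr rfl fun w _ => ?_)
    rw [map_smul, lift_word, smul_mulVec, dotProduct_smul, hx w.1 w.2, smul_eq_mul]
    ring
  set a := ∑ w : BoundedWord σ (2 * d), wordCoeff w.1 q * l w.1
  set c := ∑ w : BoundedWord σ (2 * d), wordCoeff w.1 q * l₀ w.1
  -- So small that `a + ε * c ≤ a / 2 < 0`, contradicting `key`.
  have hε : 0 < -a / (2 * (|c| + 1)) := div_pos (by linarith) (by positivity)
  have h := key _ hε
  have h2 : -a / (2 * (|c| + 1)) * c ≤ -a / 2 := by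
    rw [div_mul_eq_mul_div, div_le_div_iff₀ (by positivity) two_pos]
    nlinarith [le_abs_self c, abs_nonneg c]
  linarith

end FreeAlgebra

/-! ### The second difference and the structure of polynomials convex in some letters. -/

namespace FreeAlgebra

open Matrix

variable {σ : Type*}

/-- Midpoint convexity on symmetric matrices in the letters selected by `S`, the others fixed. -/
def MidpointConvexIn (S : σ → Bool) (p : FreeAlgebra ℝ σ) : Prop :=
  ∀ (n : ℕ) (Y Z : σ → Matrix (Fin n) (Fin n) ℝ), (∀ s, (Y s).IsSymm) → (∀ s, (Z s).IsSymm) →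
    (∀ s, S s = false → Y s = Z s) →
    ((1 / 2 : ℝ) • lift ℝ Y p + (1 / 2 : ℝ) • lift ℝ Z p -
      lift ℝ ((1 / 2 : ℝ) • Y + (1 / 2 : ℝ) • Z) p).PosSemidef

/-- The alphabet `σ` with an additional direction letter for each letter selected by `S`. -/
abbrev DirLetter (S : σ → Bool) : Type _ := σ ⊕ {s // S s = true}

/-- Forget that a letter is a direction letter. -/
def DirLetter.toLetter {S : σ → Bool} : DirLetter S → σ := Sum.elim id Subtype.val

/-- Whether a letter is an original letter selected by `S`. -/
def DirLetter.isBase {S : σ → Bool} : DirLetter S → Bool := Sum.elim S fun _ => false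

open DirLetter

@[simp] theorem toLetter_inl {S : σ → Bool} (s : σ) : toLetter (Sum.inl s : DirLetter S) = s := rfl

@[simp] theorem toLetter_inr {S : σ → Bool} (s : {s // S s = true}) :
    toLetter (Sum.inr s : DirLetter S) = s.1 := rfl

@[simp] theorem isBase_inl {S : σ → Bool} (s : σ) : isBase (Sum.inl s : DirLetter S) = S s := rfl

@[simp] theorem isBase_inr {S : σ → Bool} (s : {s // S s = true}) :
    isBase (Sum.inr s : DirLetter S) = false := rfl

variable {S : σ → Bool}

theorem countP_map_toLetter (w : List (DirLetter S)) :
    (w.map toLetter).countP S = w.countP isBase + w.countP Sum.isRight := by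
  induction w with
  | nil => simp
  | cons t w ih =>
    simp only [List.map_cons, List.countP_cons, ih]
    rcases t with s | ⟨s, hs⟩
    · simp only [toLetter_inl, isBase_inl, Sum.isRight_inl]; grind
    · simp [hs]; omega

/-- Replace the first `k` letters selected by `S` by direction letters. -/
def markFirst (S : σ → Bool) : ℕ → List σ → List (DirLetter S)
  | _, [] => []
  | 0, s :: w => Sum.inl s :: markFirst S 0 w
  | k + 1, s :: w =>
    if h : S s = true then Sum.inr ⟨s, h⟩ :: markFirst S k w else Sum.inl s :: markFirst S (k + 1) w

theorem map_toLetter_markFirst (k : ℕ) (w : List σ) : (markFirst S k w).map toLetter = w := by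
  induction w generalizing k with
  | nil => simp [markFirst]
  | cons s w ih =>
    cases k with
    | zero => simp [markFirst, ih]
    | succ k => rw [markFirst]; split_ifs <;> simp [ih]

theorem countP_isRight_markFirst (k : ℕ) (w : List σ) :
    (markFirst S k w).countP Sum.isRight = min k (w.countP S) := by
  induction w generalizing k with
  | nil => simp [markFirst]
  | cons s w ih =>
    cases k with
    | zero => simp [markFirst, ih]
    | succ k =>
      rw [markFirst]
      split_ifs with h
      · rw [List.countP_cons_of_pos rfl, ih, List.countP_cons_of_pos h]
        omega
      · simp [ih, h]

/-- A selected letter stays unmarked only after all `k` marks are spent. -/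
theorem countP_isBase_eq_zero_of_markFirst_eq_append {k : ℕ} {w : List σ}
    {u v : List (DirLetter S)} (h : markFirst S k w = u ++ v) (hu : u.countP Sum.isRight < k) :
    u.countP isBase = 0 := by
  induction w generalizing k u with
  | nil =>
    simp only [markFirst] at h
    simp [(List.nil_eq_append_iff.mp h).1]
  | cons s w ih =>
    cases k with
    | zero => omega
    | succ k =>
      cases u with
      | nil => simp
      | cons t u =>
        rw [markFirst] at h
        split_ifs at h with hs
        · rw [List.cons_append, List.cons.injEq] at h
          obtain ⟨rfl, h⟩ := h
          rw [List.countP_cons] at hu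
          have := ih h (by simpa using hu)
          rw [List.countP_cons, this]; simp
        · rw [List.cons_append, List.cons.injEq] at h
          obtain ⟨rfl, h⟩ := h
          rw [List.countP_cons] at hu
          have := ih h (by simpa using hu)
          rw [List.countP_cons, this]; simp [hs]

/-- Replace a letter selected by `S` by its direction letter. -/
def toDir (S : σ → Bool) (s : σ) : DirLetter S := if h : S s = true then Sum.inr ⟨s, h⟩ else Sum.inl s

theorem toLetter_toDir (s : σ) : toLetter (toDir S s) = s := by
  unfold toDir
  split_ifs <;> simp

theorem map_toLetter_map_toDir (w : List σ) : (w.map (toDir S)).map toLetter = w := by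
  simp [List.map_map, Function.comp_def, toLetter_toDir]

theorem countP_isRight_map_toDir (w : List σ) :
    (w.map (toDir S)).countP Sum.isRight = w.countP S := by
  rw [List.countP_map]
  congr 1
  ext s
  by_cases h : S s = true <;> simp [toDir, h]

section

variable [Fintype σ] [DecidableEq σ]

/-- The substitution `z ↦ z + ε h`, where `h` are the direction letters. -/
noncomputable def shift (S : σ → Bool) (ε : ℝ) : FreeAlgebra ℝ σ →ₐ[ℝ] FreeAlgebra ℝ (DirLetter S) :=
  lift ℝ fun s => ∑ t with toLetter t = s,
    (Sum.elim (fun _ => 1) (fun _ => ε) : DirLetter S → ℝ) t • ι ℝ t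

theorem wordCoeff_shift (ε : ℝ) (p : FreeAlgebra ℝ σ) (w : List (DirLetter S)) :
    wordCoeff w (shift S ε p) = ε ^ w.countP Sum.isRight * wordCoeff (w.map toLetter) p := by
  rw [shift, wordCoeff_lift_sum_fiber]
  congr 1
  induction w with
  | nil => simp
  | cons t w ih =>
    rw [List.map_cons, List.prod_cons, ih, List.countP_cons]
    rcases t with s | s
    · simp
    · simp [pow_succ']

/-- The symmetric second difference `p(z + h) + p(z - h) - 2 p(z)` in the letters selected by `S`. -/
noncomputable def secondDifference (S : σ → Bool) (p : FreeAlgebra ℝ σ) :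
    FreeAlgebra ℝ (DirLetter S) :=
  shift S 1 p + shift S (-1) p - (2 : ℝ) • shift S 0 p

/-- As `0 ^ 0 = 1`, the factor vanishes for zero or one direction letter and equals `2` for two. -/
theorem wordCoeff_secondDifference (p : FreeAlgebra ℝ σ) (w : List (DirLetter S)) :
    wordCoeff w (secondDifference S p) = (1 + (-1) ^ w.countP Sum.isRight -
      2 * 0 ^ w.countP Sum.isRight) * wordCoeff (w.map toLetter) p := by
  simp only [secondDifference, map_sub, map_add, map_smul, wordCoeff_shift, one_pow, smul_eq_mul]
  ring

theorem wordCoeff_secondDifference_of_countP_eq_two (p : FreeAlgebra ℝ σ) {w : List (DirLetter S)}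
    (hw : w.countP Sum.isRight = 2) :
    wordCoeff w (secondDifference S p) = 2 * wordCoeff (w.map toLetter) p := by
  rw [wordCoeff_secondDifference, hw]
  norm_num

theorem two_le_countP_of_wordCoeff_secondDifference_ne_zero {p : FreeAlgebra ℝ σ}
    {w : List (DirLetter S)} (hw : wordCoeff w (secondDifference S p) ≠ 0) :
    2 ≤ w.countP Sum.isRight ∧ wordCoeff (w.map toLetter) p ≠ 0 := by
  rw [wordCoeff_secondDifference] at hw
  refine ⟨?_, right_ne_zero_of_mul hw⟩
  by_contra h
  have h' : w.countP Sum.isRight = 0 ∨ w.countP Sum.isRight = 1 := by omega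
  rcases h' with h' | h' <;> rw [h'] at hw <;> norm_num at hw

theorem star_secondDifference {p : FreeAlgebra ℝ σ} (hp : star p = p) :
    star (secondDifference S p) = secondDifference S p := by
  refine ext_wordCoeff fun w => ?_
  rw [wordCoeff_star, wordCoeff_secondDifference, wordCoeff_secondDifference, List.countP_reverse,
    List.map_reverse, ← wordCoeff_star, hp]

/-- This is twice the midpoint inequality between `z + h` and `z - h`. At unselected letters `h` is
an empty sum, so the two tuples agree there. -/
theorem posSemidef_lift_secondDifference {p : FreeAlgebra ℝ σ} (hp : MidpointConvexIn S p) (n : ℕ)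
    (W : DirLetter S → Matrix (Fin n) (Fin n) ℝ) (hW : ∀ t, (W t).IsSymm) :
    (lift ℝ W (secondDifference S p)).PosSemidef := by
  set H : σ → Matrix (Fin n) (Fin n) ℝ := fun s =>
    ∑ t : {s // S s = true} with toLetter (Sum.inr t : DirLetter S) = s, W (Sum.inr t)
    with hH
  have hshift : ∀ ε, lift ℝ W (shift S ε p) = lift ℝ (fun s => W (Sum.inl s) + ε • H s) p := by
    intro ε
    have : (lift ℝ W).comp (shift S ε) = lift ℝ (fun s => W (Sum.inl s) + ε • H s) := by
      refine hom_ext (funext fun s => ?_)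
      simp only [AlgHom.coe_comp, Function.comp_apply, shift, lift_ι_apply, Finset.sum_filter,
        Fintype.sum_sum_type, toLetter_inl, Sum.elim_inl, Sum.elim_inr, one_smul,
        Finset.sum_ite_eq', Finset.mem_univ, if_true, map_add, map_sum, hH, Finset.smul_sum]
      congr 1
      exact Finset.sum_congr rfl fun t _ => by split_ifs <;> simp
    rw [← this]
    rfl
  have hHsymm : ∀ s, (H s)ᵀ = H s := fun s => by
    simp only [hH, transpose_sum]
    exact Finset.sum_congr rfl fun t _ => (hW _).eq
  have hH0 : ∀ s, S s = false → H s = 0 := fun s hs => by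
    refine Finset.sum_eq_zero fun t ht => ?_
    have h1 := t.2
    rw [show t.1 = s from (Finset.mem_filter.mp ht).2, hs] at h1
    exact absurd h1 (by simp)
  have h := hp n (fun s => W (Sum.inl s) + (1 : ℝ) • H s) (fun s => W (Sum.inl s) + (-1 : ℝ) • H s)
    (fun s => by simp [Matrix.IsSymm, hHsymm, (hW _).eq])
    (fun s => by simp [Matrix.IsSymm, hHsymm, (hW _).eq])
    (fun s hs => by simp [hH0 s hs])
  have havg : (1 / 2 : ℝ) • (fun s => W (Sum.inl s) + (1 : ℝ) • H s) +
      (1 / 2 : ℝ) • (fun s => W (Sum.inl s) + (-1 : ℝ) • H s) =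
      fun s => W (Sum.inl s) + (0 : ℝ) • H s := by
    ext s i j
    simp
    ring
  rw [havg, ← hshift, ← hshift, ← hshift] at h
  have h2 := h.smul (zero_le_two (α := ℝ))
  convert h2 using 1
  rw [secondDifference, map_sub, map_add, map_smul]
  module

/-- A symmetric polynomial that is convex in the letters selected by `S` has degree at most two in
these letters, and its part of degree two is a sum of hermitian squares of polynomials that are
homogeneous of degree one in them. -/
theorem exists_sum_star_mul_of_midpointConvexIn {p : FreeAlgebra ℝ σ} (hstar : star p = p)
    (hp : MidpointConvexIn S p) :
    ∃ (m : ℕ) (P : Fin m → FreeAlgebra ℝ σ),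
      (∀ k u, wordCoeff u (P k) ≠ 0 → u.countP S = 1) ∧
      ∀ w, 2 ≤ w.countP S → wordCoeff w p = wordCoeff w (∑ k, star (P k) * P k) := by
  obtain ⟨m, F, hF⟩ := exists_eq_sum_star_mul_of_posSemidef (star_secondDifference (S := S) hstar)
    (posSemidef_lift_secondDifference hp)
  have hdir : ∀ k u, wordCoeff u (F k) ≠ 0 → 1 ≤ u.countP Sum.isRight := by
    intro k u hu
    -- The negated weight selects a word with fewest direction letters; its square already has at
    -- least two of them.
    obtain ⟨v, huv, hv⟩ := exists_wordCoeff_sum_star_mul_pos F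
      (fun w => -(w.countP Sum.isRight : ℤ)) (by intro u v; simp; ring) (by simp) hu
    rw [← hF] at hv
    have h := (two_le_countP_of_wordCoeff_secondDifference_ne_zero hv.ne').1
    rw [List.countP_append, List.countP_reverse] at h
    omega
  have hdeg : ∀ w, wordCoeff w p ≠ 0 → w.countP S ≤ 2 := by
    by_contra! hcon
    obtain ⟨w₀, hw₀, hw₀2⟩ := hcon
    obtain ⟨w, hw, hmax⟩ := Set.exists_max_image _ (fun w : List σ => w.countP S)
      (finite_setOf_wordCoeff_ne_zero p) ⟨w₀, hw₀⟩
    have hw2 : 2 < w.countP S := hw₀2.trans_le (hmax w₀ hw₀)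
    -- The square of a word with most base letters has at least two direction letters besides, and
    -- its total degree is at most the maximal one.
    have hbase : ∀ k u, wordCoeff u (F k) ≠ 0 → 2 * u.countP isBase + 2 ≤ w.countP S := by
      intro k u hu
      obtain ⟨v, huv, hv⟩ := exists_wordCoeff_sum_star_mul_pos F
        (fun w => (w.countP isBase : ℤ)) (by simp) (by simp) hu
      rw [← hF] at hv
      obtain ⟨h1, h2⟩ := two_le_countP_of_wordCoeff_secondDifference_ne_zero hv.ne'
      have h3 := hmax _ h2
      simp only [countP_map_toLetter, List.countP_append, List.countP_reverse] at h1 h3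
      omega
    have hright : (markFirst S 2 w).countP Sum.isRight = 2 := by
      rw [countP_isRight_markFirst]
      omega
    have hq : wordCoeff (markFirst S 2 w) (∑ k, star (F k) * F k) ≠ 0 := by
      rw [← hF, wordCoeff_secondDifference_of_countP_eq_two p hright, map_toLetter_markFirst]
      exact mul_ne_zero two_ne_zero hw
    obtain ⟨k, u, v, huv, hu, hv⟩ := exists_append_of_wordCoeff_sum_star_mul_ne_zero hq
    have hu1 := hdir k _ hu
    have hv1 := hdir k _ hv
    have hv2 := hbase k _ hv
    have htot := countP_map_toLetter (markFirst S 2 w)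
    rw [map_toLetter_markFirst, hright, ← huv, List.countP_append] at htot
    rw [← huv, List.countP_append] at hright
    rw [List.countP_reverse] at hu1
    -- Each half has exactly one direction letter, so the left half has no base letter and all
    -- `w.countP S - 2` of them lie in `v`. Then `hbase` gives `w.countP S ≤ 2`.
    have hu0 := countP_isBase_eq_zero_of_markFirst_eq_append huv.symm (by omega)
    omega
  have hinj : Function.Injective (List.map (toDir S)) :=
    Function.LeftInverse.injective (g := List.map toLetter) map_toLetter_map_toDir
  -- The factor `(√2)⁻¹` absorbs the `2` in `wordCoeff_secondDifference_of_countP_eq_two`.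
  have hex : ∀ k, ∃ P : FreeAlgebra ℝ σ, ∀ u, wordCoeff u P =
      if u.countP S = 1 then (√2)⁻¹ * wordCoeff (u.map (toDir S)) (F k) else 0 := by
    intro k
    refine exists_wordCoeff_eq _
      (((finite_setOf_wordCoeff_ne_zero (F k)).preimage hinj.injOn).subset fun u hu => ?_)
    simp only [Set.mem_ofPred_eq, ne_eq, ite_eq_right_iff, Classical.not_imp] at hu
    exact right_ne_zero_of_mul hu.2
  choose P hP using hex
  refine ⟨m, P, fun k u hu => ?_, fun w hw => ?_⟩
  · by_contra h
    exact hu (by rw [hP, if_neg h])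
  · rw [wordCoeff_sum_star_mul]
    rcases hw.eq_or_lt with hw2 | hw2
    · have h := wordCoeff_secondDifference_of_countP_eq_two p
        (w := w.map (toDir S)) (by rw [countP_isRight_map_toDir, ← hw2])
      rw [map_toLetter_map_toDir, hF, wordCoeff_sum_star_mul, List.length_map] at h
      rw [← mul_right_inj' (two_ne_zero (α := ℝ)), ← h, Finset.mul_sum]
      refine Finset.sum_congr rfl fun k _ => ?_
      rw [Finset.mul_sum]
      refine Finset.sum_congr rfl fun i _ => ?_
      rw [← List.map_take, ← List.map_drop, ← List.map_reverse, hP, hP, List.countP_reverse]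
      have hsplit : (w.take i).countP S + (w.drop i).countP S = w.countP S := by
        rw [← List.countP_append, List.take_append_drop]
      by_cases h1 : (w.take i).countP S = 1
      · rw [if_pos h1, if_pos (by omega)]
        have h2 : (√2)⁻¹ * (√2)⁻¹ = (2 : ℝ)⁻¹ := by
          rw [← mul_inv, Real.mul_self_sqrt zero_le_two]
        linear_combination (-2 * wordCoeff ((w.take i).reverse.map (toDir S)) (F k) *
          wordCoeff ((w.drop i).map (toDir S)) (F k)) * h2
      · rw [if_neg h1, zero_mul, mul_zero]
        by_contra hne
        obtain ⟨h3, h4⟩ := mul_ne_zero_iff.mp hne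
        have h3 := hdir k _ h3
        have h4 := hdir k _ h4
        rw [countP_isRight_map_toDir] at h3 h4
        rw [List.countP_reverse] at h3
        omega
    · have h0 : wordCoeff w p = 0 := by
        by_contra h
        exact absurd (hdeg w h) (by omega)
      rw [h0]
      refine (Finset.sum_eq_zero fun k _ => Finset.sum_eq_zero fun i _ => ?_).symm
      rw [hP, hP, List.countP_reverse]
      have hsplit : (w.take i).countP S + (w.drop i).countP S = w.countP S := by
        rw [← List.countP_append, List.take_append_drop]
      by_cases h1 : (w.take i).countP S = 1
      · rw [if_neg (c := (w.drop i).countP S = 1) (by omega), mul_zero]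
      · rw [if_neg h1, zero_mul]

end

end FreeAlgebra

/-! ### Orthogonal change of a family and gluing of two families of squares. -/

/-- Two families of vectors with the same Gram matrix are related by a linear isometry. -/
theorem exists_linearIsometry_of_inner_eq {V D : Type*} [NormedAddCommGroup V]
    [InnerProductSpace ℝ V] [FiniteDimensional ℝ V] (α β : D → V)
    (h : ∀ i j, inner ℝ (α i) (α j) = inner ℝ (β i) (β j)) :
    ∃ T : V →ₗᵢ[ℝ] V, ∀ i, T (α i) = β i := by
  set A := Finsupp.linearCombination ℝ α with hA
  set B := Finsupp.linearCombination ℝ β with hB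
  -- Equal norms of all combinations make `α i ↦ β i` a well-defined isometry on the span, which
  -- extends to `V` by finite dimension.
  have hnorm : ∀ c, ‖B c‖ = ‖A c‖ := by
    intro c
    have h2 : inner ℝ (B c) (B c) = inner ℝ (A c) (A c) := by
      simp only [hA, hB, Finsupp.linearCombination_apply, Finsupp.sum, sum_inner, inner_sum,
        real_inner_smul_left, real_inner_smul_right, h]
    rw [real_inner_self_eq_norm_sq, real_inner_self_eq_norm_sq] at h2
    exact (sq_eq_sq₀ (norm_nonneg _) (norm_nonneg _)).mp h2
  have hker : LinearMap.ker A ≤ LinearMap.ker B := by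
    intro c hc
    rw [LinearMap.mem_ker] at hc ⊢
    rw [← norm_eq_zero, hnorm, hc, norm_zero]
  set f : LinearMap.range A →ₗ[ℝ] V :=
    ((LinearMap.ker A).liftQ B hker).comp A.quotKerEquivRange.symm.toLinearMap with hf
  have hfA : ∀ c, f ⟨A c, c, rfl⟩ = B c := by
    intro c
    have : A.quotKerEquivRange.symm ⟨A c, c, rfl⟩ = (LinearMap.ker A).mkQ c := by
      rw [LinearEquiv.symm_apply_eq]
      rfl
    simp [hf, this]
  let L : LinearMap.range A →ₗᵢ[ℝ] V := ⟨f, by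
    rintro ⟨_, c, rfl⟩
    rw [hfA, hnorm]
    rfl⟩
  refine ⟨L.extend, fun i => ?_⟩
  have hi : A (Finsupp.single i 1) = α i := by simp [hA]
  have h1 := L.extend_apply ⟨A (Finsupp.single i 1), _, rfl⟩
  simp only [hi] at h1
  rw [h1]
  have h2 := hfA (Finsupp.single i 1)
  simp only [hi] at h2
  exact h2.trans (by simp [hB])

namespace FreeAlgebra

variable {σ κ : Type*} [Fintype κ]

/-- If two families of polynomials have the same Gram matrix on a set of words, then an orthogonal
change of the first family makes their coefficients on these words equal. -/
theorem exists_orthogonal_change (P Q : κ → FreeAlgebra ℝ σ) (D : Set (List σ))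
    (h : ∀ u ∈ D, ∀ v ∈ D, ∑ k, wordCoeff u (P k) * wordCoeff v (P k) =
      ∑ k, wordCoeff u (Q k) * wordCoeff v (Q k)) :
    ∃ P' : κ → FreeAlgebra ℝ σ,
      (∀ u v, ∑ k, wordCoeff u (P' k) * wordCoeff v (P' k) =
        ∑ k, wordCoeff u (P k) * wordCoeff v (P k)) ∧
      ∀ u ∈ D, ∀ k, wordCoeff u (P' k) = wordCoeff u (Q k) := by
  classical
  let a : (κ → FreeAlgebra ℝ σ) → List σ → EuclideanSpace ℝ κ :=
    fun R u => WithLp.toLp 2 fun k => wordCoeff u (R k)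
  have ha : ∀ R u v, inner ℝ (a R u) (a R v) = ∑ k, wordCoeff u (R k) * wordCoeff v (R k) := by
    intro R u v
    simp [a, PiLp.inner_apply, mul_comm]
  obtain ⟨T, hT⟩ := exists_linearIsometry_of_inner_eq (fun u : D => a P u) (fun u : D => a Q u)
    fun u v => by rw [ha, ha, h u u.2 v v.2]
  let P' : κ → FreeAlgebra ℝ σ := fun k => ∑ j, T (EuclideanSpace.single j 1) k • P j
  have hP' : ∀ u, a P' u = T (a P u) := by
    intro u
    have hsum : a P u = ∑ j, wordCoeff u (P j) • EuclideanSpace.single j (1 : ℝ) := by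
      ext k
      simp [a, Pi.single_apply]
    rw [hsum, map_sum]
    ext k
    simp [a, P', mul_comm]
  refine ⟨P', fun u v => ?_, fun u hu k => ?_⟩
  · rw [← ha, ← ha, hP', hP', T.inner_map_map]
  · have h1 := (hP' u).trans (hT ⟨u, hu⟩)
    exact congrArg (fun x : EuclideanSpace ℝ κ => x k) h1

/-- A word of length `2 * n` splits into two of length at most `n` only in the middle. Hence the
polynomial determines the Gram matrix of the family on words of top length. -/
theorem wordCoeff_reverse_append_sum_star_mul (P : κ → FreeAlgebra ℝ σ) {n : ℕ}
    (hP : ∀ k u, wordCoeff u (P k) ≠ 0 → u.length ≤ n) {u v : List σ} (hu : u.length = n)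
    (hv : v.length = n) :
    wordCoeff (u.reverse ++ v) (∑ k, star (P k) * P k) =
      ∑ k, wordCoeff u (P k) * wordCoeff v (P k) := by
  rw [wordCoeff_sum_star_mul]
  refine Finset.sum_congr rfl fun k _ => ?_
  rw [Finset.sum_eq_single n]
  · rw [List.take_left' (by simpa), List.drop_left' (by simpa), List.reverse_reverse]
  · intro i hi hne
    by_contra hmul
    obtain ⟨h1, h2⟩ := mul_ne_zero_iff.mp hmul
    have h1 := hP k _ h1
    have h2 := hP k _ h2
    simp only [List.length_reverse, List.length_take, List.length_drop, List.length_append,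
      Finset.mem_range] at h1 h2 hi
    omega
  · simp only [Finset.mem_range, List.length_append, List.length_reverse]
    omega

theorem countP_eq_two_of_wordCoeff_sum_star_mul_ne_zero {S : σ → Bool} {P : κ → FreeAlgebra ℝ σ}
    (hP : ∀ k u, wordCoeff u (P k) ≠ 0 → u.countP S = 1) {w : List σ}
    (hw : wordCoeff w (∑ k, star (P k) * P k) ≠ 0) : w.countP S = 2 := by
  obtain ⟨k, u, v, rfl, hu, hv⟩ := exists_append_of_wordCoeff_sum_star_mul_ne_zero hw
  have hu := hP k _ hu
  have hv := hP k _ hv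
  rw [List.countP_reverse] at hu
  rw [List.countP_append, hu, hv]

/-- Two halves of degree at most one in `S` reach total degree two only if both have degree exactly
one, so no other Gram entries enter. -/
theorem wordCoeff_sum_star_mul_congr {S : σ → Bool} {P Λ : κ → FreeAlgebra ℝ σ}
    (hP : ∀ k u, wordCoeff u (P k) ≠ 0 → u.countP S = 1)
    (hΛ : ∀ k u, wordCoeff u (Λ k) ≠ 0 → u.countP S ≤ 1)
    (h : ∀ u v, u.countP S = 1 → v.countP S = 1 → ∑ k, wordCoeff u (Λ k) * wordCoeff v (Λ k) =
      ∑ k, wordCoeff u (P k) * wordCoeff v (P k)) {w : List σ} (hw : 2 ≤ w.countP S) :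
    wordCoeff w (∑ k, star (Λ k) * Λ k) = wordCoeff w (∑ k, star (P k) * P k) := by
  rw [wordCoeff_sum_star_mul, wordCoeff_sum_star_mul, Finset.sum_comm,
    Finset.sum_comm (s := Finset.univ)]
  refine Finset.sum_congr rfl fun i _ => ?_
  have hsplit : (w.take i).reverse.countP S + (w.drop i).countP S = w.countP S := by
    rw [List.countP_reverse, ← List.countP_append, List.take_append_drop]
  by_cases hi : (w.take i).reverse.countP S = 1 ∧ (w.drop i).countP S = 1
  · exact h _ _ hi.1 hi.2
  · rw [Finset.sum_eq_zero fun k _ => ?_, Finset.sum_eq_zero fun k _ => ?_]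
    · by_contra hmul
      obtain ⟨h1, h2⟩ := mul_ne_zero_iff.mp hmul
      exact hi ⟨hP k _ h1, hP k _ h2⟩
    · by_contra hmul
      obtain ⟨h1, h2⟩ := mul_ne_zero_iff.mp hmul
      have h1 := hΛ k _ h1
      have h2 := hΛ k _ h2
      omega

/-- The square of a word of largest `T`-degree survives in `p`, whose words of `T`-degree at least
two have `T`-degree exactly two. -/
theorem countP_le_one_of_sum_star_mul {S T : σ → Bool} {κ' : Type*} [Fintype κ']
    {p : FreeAlgebra ℝ σ} {P : κ → FreeAlgebra ℝ σ} {Q : κ' → FreeAlgebra ℝ σ}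
    (hP : ∀ k u, wordCoeff u (P k) ≠ 0 → u.countP S = 1)
    (hPp : ∀ w, 2 ≤ w.countP S → wordCoeff w p = wordCoeff w (∑ k, star (P k) * P k))
    (hQ : ∀ k u, wordCoeff u (Q k) ≠ 0 → u.countP T = 1)
    (hQp : ∀ w, 2 ≤ w.countP T → wordCoeff w p = wordCoeff w (∑ k, star (Q k) * Q k))
    (k : κ) (u : List σ) (hu : wordCoeff u (P k) ≠ 0) : u.countP T ≤ 1 := by
  obtain ⟨v, huv, hv⟩ := exists_wordCoeff_sum_star_mul_pos P
    (fun w => (w.countP T : ℤ)) (by simp) (by simp) hu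
  have hS := countP_eq_two_of_wordCoeff_sum_star_mul_ne_zero hP hv.ne'
  have hp := hv.ne'
  rw [← hPp _ hS.ge] at hp
  by_contra hlt
  have h2 : 2 < (v.reverse ++ v).countP T := by
    rw [List.countP_append, List.countP_reverse]
    omega
  rw [hQp _ h2.le] at hp
  exact h2.ne' (countP_eq_two_of_wordCoeff_sum_star_mul_ne_zero hQ hp)

/-- A symmetric polynomial that is convex in two complementary sets of letters separately is a sum
of hermitian squares, up to a polynomial of degree at most one in each of the two sets, with squares
of polynomials of degree at most one in each of the two sets. -/
theorem exists_eq_add_sum_star_mul_of_midpointConvexIn [Finite σ] {S T : σ → Bool}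
    (hST : ∀ w : List σ, w.length = w.countP T + w.countP S)
    {p : FreeAlgebra ℝ σ} (hstar : star p = p) (hS : MidpointConvexIn S p)
    (hT : MidpointConvexIn T p) :
    ∃ (m : ℕ) (L : FreeAlgebra ℝ σ) (Λ : Fin m → FreeAlgebra ℝ σ),
      p = L + ∑ j, star (Λ j) * Λ j ∧
      (∀ w, wordCoeff w L ≠ 0 → w.countP T ≤ 1 ∧ w.countP S ≤ 1) ∧
      ∀ j w, wordCoeff w (Λ j) ≠ 0 → w.countP T ≤ 1 ∧ w.countP S ≤ 1 := by
  classical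
  have := Fintype.ofFinite σ
  obtain ⟨m₁, P₁, hP₁, hPp₁⟩ := exists_sum_star_mul_of_midpointConvexIn hstar hS
  obtain ⟨m₂, Q₂, hQ₂, hQp₂⟩ := exists_sum_star_mul_of_midpointConvexIn hstar hT
  obtain ⟨P, hP, hPp⟩ : ∃ P : Fin (m₁ + m₂) → FreeAlgebra ℝ σ,
      (∀ k u, wordCoeff u (P k) ≠ 0 → u.countP S = 1) ∧
      ∀ w, 2 ≤ w.countP S → wordCoeff w p = wordCoeff w (∑ k, star (P k) * P k) := by
    -- Padding with zeros gives both families the same index set, as the orthogonal change requires.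
    refine ⟨Fin.append P₁ 0, fun k => ?_, fun w hw => ?_⟩
    · refine Fin.addCases (fun i => ?_) (fun i => ?_) k
      · simpa using hP₁ i
      · simp
    · rw [hPp₁ w hw, Fin.sum_univ_add]
      simp
  obtain ⟨Q, hQ, hQp⟩ : ∃ Q : Fin (m₁ + m₂) → FreeAlgebra ℝ σ,
      (∀ k u, wordCoeff u (Q k) ≠ 0 → u.countP T = 1) ∧
      ∀ w, 2 ≤ w.countP T → wordCoeff w p = wordCoeff w (∑ k, star (Q k) * Q k) := by
    refine ⟨Fin.append 0 Q₂, fun k => ?_, fun w hw => ?_⟩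
    · refine Fin.addCases (fun i => ?_) (fun i => ?_) k
      · simp
      · simpa using hQ₂ i
    · rw [hQp₂ w hw, Fin.sum_univ_add]
      simp
  have hPT := countP_le_one_of_sum_star_mul hP hPp hQ hQp
  have hQS := countP_le_one_of_sum_star_mul hQ hQp hP hPp
  have hgram : ∀ u ∈ {u : List σ | u.countP S = 1 ∧ u.countP T = 1},
      ∀ v ∈ {u : List σ | u.countP S = 1 ∧ u.countP T = 1},
      ∑ k, wordCoeff u (P k) * wordCoeff v (P k) = ∑ k, wordCoeff u (Q k) * wordCoeff v (Q k) := by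
    rintro u ⟨huS, huT⟩ v ⟨hvS, hvT⟩
    have hu : u.length = 2 := by rw [hST, huS, huT]
    have hv : v.length = 2 := by rw [hST, hvS, hvT]
    rw [← wordCoeff_reverse_append_sum_star_mul P (fun k w hw => ?_) hu hv,
      ← wordCoeff_reverse_append_sum_star_mul Q (fun k w hw => ?_) hu hv, ← hPp, ← hQp]
    · simp [huT, hvT]
    · simp [huS, hvS]
    · have h1 := hQ k w hw
      have h2 := hQS k w hw
      have := hST w
      omega
    · have h1 := hP k w hw
      have h2 := hPT k w hw
      have := hST w
      omega
  obtain ⟨P', hP'gram, hP'Q⟩ := exists_orthogonal_change P Q _ hgram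
  have hP' : ∀ k u, wordCoeff u (P' k) ≠ 0 → ∃ j, wordCoeff u (P j) ≠ 0 := by
    intro k u hu
    by_contra! hzero
    have h1 := hP'gram u u
    simp only [hzero, mul_zero, Finset.sum_const_zero] at h1
    rw [Finset.sum_eq_zero_iff_of_nonneg fun _ _ => mul_self_nonneg _] at h1
    exact hu (mul_self_eq_zero.mp (h1 k (Finset.mem_univ _)))
  -- The gluing: on words of degree one in both sets `P'` and `Q` agree, so `Λ` restricts to `P'` on
  -- `S`-degree one and to `Q` on `T`-degree one.
  have hex : ∀ k, ∃ R : FreeAlgebra ℝ σ, ∀ u, wordCoeff u R =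
      if u.countP S = 1 then wordCoeff u (P' k) else wordCoeff u (Q k) := by
    intro k
    refine exists_wordCoeff_eq _ (((finite_setOf_wordCoeff_ne_zero (P' k)).union
      (finite_setOf_wordCoeff_ne_zero (Q k))).subset fun u hu => ?_)
    simp only [Set.mem_ofPred_eq] at hu
    split_ifs at hu
    · exact Or.inl hu
    · exact Or.inr hu
  choose Λ hΛ using hex
  have hΛS : ∀ k u, u.countP S = 1 → wordCoeff u (Λ k) = wordCoeff u (P' k) := fun k u hu => by
    rw [hΛ, if_pos hu]
  have hΛT : ∀ k u, u.countP T = 1 → wordCoeff u (Λ k) = wordCoeff u (Q k) := fun k u hu => by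
    rw [hΛ]
    split_ifs with h
    · exact hP'Q u ⟨h, hu⟩ k
    · rfl
  have hdeg : ∀ k u, wordCoeff u (Λ k) ≠ 0 → u.countP T ≤ 1 ∧ u.countP S ≤ 1 := by
    intro k u hu
    rw [hΛ] at hu
    split_ifs at hu with h
    · obtain ⟨j, hj⟩ := hP' k u hu
      exact ⟨hPT j u hj, h.le⟩
    · exact ⟨(hQ k u hu).le, hQS k u hu⟩
  refine ⟨m₁ + m₂, p - ∑ j, star (Λ j) * Λ j, Λ, (sub_add_cancel _ _).symm, fun w hw => ?_, hdeg⟩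
  rw [map_sub, sub_ne_zero] at hw
  constructor
  · by_contra! h
    refine hw ((hQp w h).trans (wordCoeff_sum_star_mul_congr hQ (fun k u hu => (hdeg k u hu).1)
      (fun u v hu hv => ?_) h).symm)
    simp only [hΛT _ u hu, hΛT _ v hv]
  · by_contra! h
    refine hw ((hPp w h).trans (wordCoeff_sum_star_mul_congr hP (fun k u hu => (hdeg k u hu).2)
      (fun u v hu hv => ?_) h).symm)
    simp only [hΛS _ u hu, hΛS _ v hv, hP'gram]

end FreeAlgebra

/-! ### Back to the letters `a` and `x`. -/

namespace NCPoly

open FreeAlgebra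

variable {ga gx : ℕ} {p : NCPoly ga gx}

theorem ConvexInX.midpointConvexIn (hp : p.ConvexInX) : MidpointConvexIn Sum.isRight p := by
  intro n Y Z hY hZ hYZ
  have h := hp n (Y ∘ Sum.inl) (Y ∘ Sum.inr) (Z ∘ Sum.inr) (fun _ => hY _) (fun _ => hY _)
    (fun _ => hZ _) (1 / 2) (by norm_num) (by norm_num)
  have hl : Y ∘ Sum.inl = Z ∘ Sum.inl := funext fun i => hYZ _ rfl
  have hsum : Sum.elim (Y ∘ Sum.inl) ((1 / 2 : ℝ) • (Y ∘ Sum.inr) + (1 / 2 : ℝ) • (Z ∘ Sum.inr)) =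
      (1 / 2 : ℝ) • Y + (1 / 2 : ℝ) • Z := by
    funext s
    rcases s with i | j
    · simp only [Sum.elim_inl, Function.comp_apply, Pi.add_apply, Pi.smul_apply,
        ← hYZ (Sum.inl i) rfl, ← add_smul]
      norm_num
    · rfl
  rw [show (1 : ℝ) - 1 / 2 = 1 / 2 by norm_num] at h
  simp only [eval] at h
  rwa [hsum, Sum.elim_comp_inl_inr, hl, Sum.elim_comp_inl_inr] at h

theorem ConvexInA.midpointConvexIn (hp : p.ConvexInA) : MidpointConvexIn Sum.isLeft p := by
  intro n Y Z hY hZ hYZ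
  have h := hp n (Y ∘ Sum.inl) (Z ∘ Sum.inl) (Y ∘ Sum.inr) (fun _ => hY _) (fun _ => hZ _)
    (fun _ => hY _) (1 / 2) (by norm_num) (by norm_num)
  have hr : Y ∘ Sum.inr = Z ∘ Sum.inr := funext fun i => hYZ _ rfl
  have hsum : Sum.elim ((1 / 2 : ℝ) • (Y ∘ Sum.inl) + (1 / 2 : ℝ) • (Z ∘ Sum.inl)) (Y ∘ Sum.inr) =
      (1 / 2 : ℝ) • Y + (1 / 2 : ℝ) • Z := by
    funext s
    rcases s with i | j
    · rfl
    · simp only [Sum.elim_inr, Function.comp_apply, Pi.add_apply, Pi.smul_apply,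
        ← hYZ (Sum.inr j) rfl, ← add_smul]
      norm_num
  rw [show (1 : ℝ) - 1 / 2 = 1 / 2 by norm_num] at h
  simp only [eval] at h
  rwa [hsum, Sum.elim_comp_inl_inr, hr, Sum.elim_comp_inl_inr] at h

theorem length_eq_countP_isLeft_add_countP_isRight {α β : Type*} (w : List (α ⊕ β)) :
    w.length = w.countP Sum.isLeft + w.countP Sum.isRight := by
  rw [List.length_eq_countP_add_countP Sum.isLeft]
  congr 2
  ext s
  cases s <;> simp

theorem degree_le (h : ∀ w, wordCoeff w p ≠ 0 → w.countP Sum.isLeft ≤ 1 ∧ w.countP Sum.isRight ≤ 1) :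
    p.aDegree ≤ 1 ∧ p.xDegree ≤ 1 ∧ p.jointDegree ≤ 2 := by
  have hmem : ∀ w ∈ p.words, w.toList.countP Sum.isLeft ≤ 1 ∧ w.toList.countP Sum.isRight ≤ 1 :=
    fun w hw => h w.toList (Finsupp.mem_support_iff.mp hw)
  refine ⟨Finset.sup_le fun w hw => (hmem w hw).1, Finset.sup_le fun w hw => (hmem w hw).2,
    Finset.sup_le fun w hw => ?_⟩
  rw [length_eq_countP_isLeft_add_countP_isRight]
  exact add_le_add (hmem w hw).1 (hmem w hw).2

end NCPoly

theorem mainTheorem4 (ga gx : ℕ) (p : NCPoly ga gx) (hsymm : star p = p)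
    (hx : p.ConvexInX) (ha : p.ConvexInA) :
    ∃ (m : ℕ) (L : NCPoly ga gx) (Λ : Fin m → NCPoly ga gx),
      p = L + ∑ j, star (Λ j) * Λ j ∧
      (L.aDegree ≤ 1 ∧ L.xDegree ≤ 1 ∧ L.jointDegree ≤ 2) ∧
      (∀ j, (Λ j).aDegree ≤ 1 ∧ (Λ j).xDegree ≤ 1 ∧ (Λ j).jointDegree ≤ 2) := by
  obtain ⟨m, L, Λ, hp, hL, hΛ⟩ := FreeAlgebra.exists_eq_add_sum_star_mul_of_midpointConvexIn
    NCPoly.length_eq_countP_isLeft_add_countP_isRight hsymm hx.midpointConvexIn ha.midpointConvexIn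
  exact ⟨m, L, Λ, hp, NCPoly.degree_le hL, fun j => NCPoly.degree_le (hΛ j)⟩
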